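/- Let $T\subseteq\mathbb{R}$ be the field of totally real numbers, i.e. the maximal Galois extension of $\mathbb{Q}$ inside $\mathbb{R}$, and let $\mathcal{O}_T$ be its ring of integers, i.e. the integral closure of $\mathbb{Z}$ in $T$. Let $\mathcal{L}_{ring}=\{+,\cdot\,;0,1\}$ be the first-order language of rings. (a) The first-order theory $\mathrm{Th}(\mathcal{O}_T)$ of the $\mathcal{L}_{ring}$-structure $\mathcal{O}_T$ is undecidable: there is no algorithm which, given (the Gödel number of) an arbitrary $\mathcal{L}_{ring}$-sentence $\alpha$, halts with output YES if $\mathcal{O}_T\models\alpha$ and with output NO otherwise. (b) The set $\mathbb{N}$ of natural numbers is definable in $\mathcal{O}_T$ by an $\mathcal{L}_{ring}$-formula without parameters. (c) For $t\in\mathcal{O}_T$ and $M\in\mathbb{R}$ write $0\ll t\ll M$ if $0<\sigma(t)<M$ for every field embedding $\sigma:T\to\mathbb{R}$. Then $$\min\{M\in\mathbb{R}\mid \text{there are infinitely many } t\in\mathcal{O}_T \text{ with } 0\ll t\ll M\}=4.$$ -/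

import Mathlib

open FirstOrder NumberField

/-- The function symbols of the language of rings `{+, ·; 0, 1}`. -/
inductive RingSymbol : ℕ → Type
  | add : RingSymbol 2
  | mul : RingSymbol 2
  | zero : RingSymbol 0
  | one : RingSymbol 0

/-- The first-order language of rings `{+, ·; 0, 1}` (equality is a logical symbol). -/
def ringLanguage : Language :=
  { Functions := RingSymbol
    Relations := fun _ => Empty }

/-- Every (commutative) ring is a structure for the language of rings, in the obvious way. -/
instance ringLanguageStructure (R : Type*) [CommRing R] : ringLanguage.Structure R where
  funMap := fun {_} f =>
    match f with
    | .add => fun x => x 0 + x 1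
    | .mul => fun x => x 0 * x 1
    | .zero => fun _ => 0
    | .one => fun _ => 1
  RelMap := fun r => r.elim

namespace ringLanguage

/-- The code of a term with a given head symbol, from the codes of its arguments. -/
def symbolCode : {k : ℕ} → RingSymbol k → (Fin k → ℕ) → ℕ
  | _, .zero, _ => Nat.pair 1 0
  | _, .one, _ => Nat.pair 2 0
  | _, .add, c => Nat.pair 3 (Nat.pair (c 0) (c 1))
  | _, .mul, c => Nat.pair 4 (Nat.pair (c 0) (c 1))

/-- The Gödel number of a term in the variables `v₀, …, v_{n-1}`. -/
def termCode {n : ℕ} : ringLanguage.Term (Empty ⊕ Fin n) → ℕ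
  | .var (.inl e) => e.elim
  | .var (.inr i) => Nat.pair 0 i
  | .func f ts => symbolCode f (fun i => termCode (ts i))

/-- The Gödel number of a formula whose free variables are among `v₀, …, v_{n-1}`; the
quantifier `∀` applied to it binds the variable `v_{n-1}`. -/
def formulaCode : {n : ℕ} → ringLanguage.BoundedFormula Empty n → ℕ
  | _, .falsum => Nat.pair 0 0
  | _, .equal s t => Nat.pair 1 (Nat.pair (termCode s) (termCode t))
  | _, .rel r _ => Empty.elim r
  | _, .imp φ ψ => Nat.pair 2 (Nat.pair (formulaCode φ) (formulaCode ψ))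
  | _, .all φ => Nat.pair 3 (formulaCode φ)

/-- The Gödel number of a sentence of the language of rings. -/
def godelNumber (φ : ringLanguage.Sentence) : ℕ := formulaCode φ

theorem termCode_injective {n : ℕ} :
    Function.Injective (termCode : ringLanguage.Term (Empty ⊕ Fin n) → ℕ) := by
  intro s
  induction s with
  | var x =>
    intro t h
    rcases x with e | i
    · exact e.elim
    · rcases t with (e | j) | ⟨g, us⟩
      · exact e.elim
      · simp only [termCode, Nat.pair_eq_pair, true_and] at h
        rw [Fin.ext h]
      · change RingSymbol _ at g
        cases g <;> simp [termCode, symbolCode, Nat.pair_eq_pair] at h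
  | func f ts ih =>
    intro t h
    rcases t with (e | j) | ⟨g, us⟩
    · exact e.elim
    · change RingSymbol _ at f
      cases f <;> simp [termCode, symbolCode, Nat.pair_eq_pair] at h
    · change RingSymbol _ at f
      change RingSymbol _ at g
      cases f <;> cases g <;> simp [termCode, symbolCode, Nat.pair_eq_pair] at h
      · congr 1; funext i; fin_cases i
        · exact ih 0 h.1
        · exact ih 1 h.2
      · congr 1; funext i; fin_cases i
        · exact ih 0 h.1
        · exact ih 1 h.2
      · congr 1; funext i; exact i.elim0
      · congr 1; funext i; exact i.elim0

theorem formulaCode_injective {n : ℕ} :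
    Function.Injective (formulaCode : ringLanguage.BoundedFormula Empty n → ℕ) := by
  intro φ
  induction φ with
  | falsum =>
    intro ψ h
    cases ψ with
    | falsum => rfl
    | rel r _ => exact Empty.elim r
    | _ => simp [formulaCode, Nat.pair_eq_pair] at h
  | equal s t =>
    intro ψ h
    cases ψ with
    | equal s' t' =>
      simp only [formulaCode, Nat.pair_eq_pair, true_and] at h
      rw [termCode_injective h.1, termCode_injective h.2]
    | rel r _ => exact Empty.elim r
    | _ => simp [formulaCode, Nat.pair_eq_pair] at h
  | rel r _ => exact Empty.elim r
  | imp φ₁ φ₂ ih₁ ih₂ =>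
    intro ψ h
    cases ψ with
    | imp ψ₁ ψ₂ =>
      simp only [formulaCode, Nat.pair_eq_pair, true_and] at h
      rw [ih₁ h.1, ih₂ h.2]
    | rel r _ => exact Empty.elim r
    | _ => simp [formulaCode, Nat.pair_eq_pair] at h
  | all φ ih =>
    intro ψ h
    cases ψ with
    | all ψ =>
      simp only [formulaCode, Nat.pair_eq_pair, true_and] at h
      rw [ih h]
    | rel r _ => exact Empty.elim r
    | _ => simp [formulaCode, Nat.pair_eq_pair] at h

/-- Distinct sentences have distinct Gödel numbers. -/
theorem godelNumber_injective : Function.Injective godelNumber :=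
  formulaCode_injective

/-- A set of sentences of the language of rings is decidable if some algorithm (partial recursive
function), run on (the Gödel number of) an arbitrary sentence, halts with the output YES if the
sentence belongs to the set and with the output NO otherwise. -/
def DecidableTheory (S : ringLanguage.Theory) : Prop :=
  ∃ f : ℕ →. Bool, Partrec f ∧ ∀ φ : ringLanguage.Sentence,
    (φ ∈ S → true ∈ f (godelNumber φ)) ∧ (φ ∉ S → false ∈ f (godelNumber φ))

end ringLanguage

/-- The field `T` of totally real numbers: the maximal Galois extension of `ℚ` inside `ℝ`. -/
noncomputable def totallyRealNumbers : IntermediateField ℚ ℝ :=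
  sSup {F : IntermediateField ℚ ℝ | IsGalois ℚ F}

/-- `T` is indeed the largest subfield of `ℝ` that is Galois over `ℚ`. -/
theorem totallyRealNumbers_isGreatest :
    IsGreatest {F : IntermediateField ℚ ℝ | IsGalois ℚ F} totallyRealNumbers := by
  refine ⟨?_, fun F hF => le_sSup hF⟩
  have hs : totallyRealNumbers =
      ⨆ F : {F : IntermediateField ℚ ℝ | IsGalois ℚ F}, (F : IntermediateField ℚ ℝ) :=
    sSup_eq_iSup' _
  have hn : Normal ℚ totallyRealNumbers := by
    rw [hs]
    exact @IntermediateField.normal_iSup _ _ _ _ _ _ _ fun F => by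
      have hF : IsGalois ℚ (F : IntermediateField ℚ ℝ) := F.2
      exact hF.to_normal
  exact ⟨⟩

/-!
The algebraic integers all of whose conjugates are real and lie in an interval of length less than
`4` are finite in number: the monic Chebyshev polynomials of the interval tend to `0` on it, so by
the pigeonhole principle (Fekete) some nonzero integer polynomial `f` has `|f| < 1` there. The
conjugates of `f(t)` then have absolute value less than `1`, so that their product, an integer,
vanishes. On the other hand, if `0 ≪ t ≪ 4`, then `t = x²` with `x` totally real, and `2 + x`
is again between `0` and `4` at all embeddings, but `2 + x > x²` if `0 ≤ x < 2`: the integers with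
`0 ≪ t ≪ 4` are infinite in number, and the minimum `4` is attained.

Since `0 ≪ t` is expressed by "`t` is a nonzero square", the sets `{s | 0 ≪ b s ≪ a}` with
`a ≪ 4 b` form a definable family of finite sets of unbounded cardinality (J. Robinson). By the
Chinese remainder theorem, the residues of a single number `g` modulo the numbers `1 + (1 + s) d`
realize any prescribed values on such a set. So `x` is a natural number if and only if some such
finite set of residues contains `0` and is closed under `v ↦ v + 1` except at `v = x`.

Gödel's `β` function makes every partial recursive function definable in `ℕ`, hence in any ring
in which `ℕ` is definable; a decision procedure for its theory would solve the halting problem.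
-/

section Definability

open Set

variable {L : Language} {M : Type*} [L.Structure M] {A : Set M} {α β : Type*}

/-- A predicate on tuples that is definable over `A`; this is `Set.Definable` in a form on which
`fun_prop` can work. -/
@[fun_prop]
def DefinablePred (L : Language) [L.Structure M] (A : Set M) (P : (α → M) → Prop) : Prop :=
  A.Definable L {v | P v}

namespace DefinablePred

variable {P Q : (α → M) → Prop}

@[fun_prop]
theorem not (hP : DefinablePred L A P) : DefinablePred L A fun v => ¬ P v := hP.compl

@[fun_prop]
theorem and (hP : DefinablePred L A P) (hQ : DefinablePred L A Q) :
    DefinablePred L A fun v => P v ∧ Q v :=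
  hP.inter hQ

@[fun_prop]
theorem or (hP : DefinablePred L A P) (hQ : DefinablePred L A Q) :
    DefinablePred L A fun v => P v ∨ Q v :=
  hP.union hQ

@[fun_prop]
theorem imp (hP : DefinablePred L A P) (hQ : DefinablePred L A Q) :
    DefinablePred L A fun v => P v → Q v := by
  simpa only [imp_iff_not_or] using hP.not.or hQ

@[fun_prop]
theorem eq {f g : (α → M) → M} (hf : A.DefinableFun L f) (hg : A.DefinableFun L g) :
    DefinablePred L A fun v => f v = g v :=
  hf.ofPred_eq hg

@[fun_prop]
theorem ex {P : (α → M) → M → Prop}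
    (hP : DefinablePred L A fun w : Option α → M => P (fun a => w (some a)) (w none)) :
    DefinablePred L A fun v => ∃ x, P v x := by
  have h := (hP.preimage_comp fun o => o.elim (Sum.inr ()) Sum.inl).exists_of_finite
  refine (congrArg (A.Definable L) (Set.ext fun v => ?_)).mp h
  exact ⟨fun ⟨u, hu⟩ => ⟨u (), hu⟩, fun ⟨x, hx⟩ => ⟨fun _ => x, hx⟩⟩

@[fun_prop]
theorem all {P : (α → M) → M → Prop}
    (hP : DefinablePred L A fun w : Option α → M => P (fun a => w (some a)) (w none)) :
    DefinablePred L A fun v => ∀ x, P v x := by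
  simpa only [not_exists, not_not] using (ex (P := fun v x => ¬ P v x) hP.not).not

theorem congr (hP : DefinablePred L A P) (h : ∀ v, P v ↔ Q v) : DefinablePred L A Q :=
  (funext fun v => propext (h v) : P = Q) ▸ hP

theorem reindex (hP : DefinablePred L A P) (e : α → β) :
    DefinablePred L A fun v : β → M => P (v ∘ e) :=
  hP.preimage_comp e

theorem comp [Finite β] {P : (β → M) → Prop} (hP : DefinablePred L A P) {f : β → (α → M) → M}
    (hf : ∀ b, A.DefinableFun L (f b)) : DefinablePred L A fun v => P fun b => f b v :=
  hP.preimage_map hf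

theorem comp₂ {r : M → M → Prop} (hr : DefinablePred L A fun v : Fin 2 → M => r (v 0) (v 1))
    {f g : (α → M) → M} (hf : A.DefinableFun L f) (hg : A.DefinableFun L g) :
    DefinablePred L A fun v => r (f v) (g v) :=
  hr.comp (f := ![f, g]) (by simp [Fin.forall_fin_two, hf, hg])

theorem mem_of_definable₁ {s : Set M} (hs : A.Definable₁ L s) {f : (α → M) → M}
    (hf : A.DefinableFun L f) : DefinablePred L A fun v => f v ∈ s :=
  comp hs fun _ : Fin 1 => hf

end DefinablePred

/-- A partial function is definable over `A` if its graph is. -/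
@[fun_prop]
def DefinableGraph (L : Language) [L.Structure M] (A : Set M) (F : M → Part M) : Prop :=
  DefinablePred L A fun v : Fin 2 → M => v 1 ∈ F (v 0)

@[fun_prop]
theorem DefinablePred.mem {F : M → Part M} (hF : DefinableGraph L A F)
    {f g : (α → M) → M} (hf : A.DefinableFun L f) (hg : A.DefinableFun L g) :
    DefinablePred L A fun v => g v ∈ F (f v) :=
  DefinablePred.comp₂ (r := fun x y => y ∈ F x) hF hf hg

theorem definableFun_comp₁ {F : M → M} (hF : DefinablePred L A fun v : Fin 2 → M => v 1 = F (v 0))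
    {f : (α → M) → M} (hf : A.DefinableFun L f) :
    A.DefinableFun L fun v => F (f v) := by
  have hgraph := hF.comp (f := fun b (w : Option Unit → M) => ![w (some ()), w none] b)
    (by simp [Fin.forall_fin_two, Set.DefinableFun.proj])
  exact Set.DefinableFun.comp (f := fun w => F (w ())) (g := fun v _ => f v) (fun _ => hf)
    (hgraph.congr fun w => eq_comm)

theorem definableFun_comp₂ {F : M → M → M}
    (hF : DefinablePred L A fun v : Fin 3 → M => v 2 = F (v 0) (v 1)) {f g : (α → M) → M}
    (hf : A.DefinableFun L f) (hg : A.DefinableFun L g) :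
    A.DefinableFun L fun v => F (f v) (g v) := by
  have hgraph := hF.comp
    (f := fun b (w : Option (Fin 2) → M) => ![w (some 0), w (some 1), w none] b)
    (by simp [Fin.forall_fin_succ, Set.DefinableFun.proj])
  exact Set.DefinableFun.comp (f := fun w => F (w 0) (w 1)) (g := fun v => ![f v, g v])
    (by simp [DefinableMap, Fin.forall_fin_two, hf, hg]) (hgraph.congr fun w => eq_comm)

theorem definableFun_funMap {n : ℕ} (s : L.Functions n) {f : Fin n → (α → M) → M}
    (hf : ∀ i, A.DefinableFun L (f i)) :
    A.DefinableFun L fun v => Language.Structure.funMap s fun i => f i v :=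
  .comp hf (.mono (.fun_symbol s) (Set.empty_subset A))

end Definability

namespace ringLanguage

/-- The symbols of the language of rings are interpreted in `R` by the operations of the semiring
`R`. -/
class IsStandard (R : Type*) [Semiring R] [ringLanguage.Structure R] : Prop where
  funMap_add (x : Fin 2 → R) :
    Language.Structure.funMap (L := ringLanguage) RingSymbol.add x = x 0 + x 1
  funMap_mul (x : Fin 2 → R) :
    Language.Structure.funMap (L := ringLanguage) RingSymbol.mul x = x 0 * x 1
  funMap_zero (x : Fin 0 → R) :
    Language.Structure.funMap (L := ringLanguage) RingSymbol.zero x = 0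
  funMap_one (x : Fin 0 → R) :
    Language.Structure.funMap (L := ringLanguage) RingSymbol.one x = 1

instance (R : Type*) [CommRing R] : IsStandard R :=
  ⟨fun _ => rfl, fun _ => rfl, fun _ => rfl, fun _ => rfl⟩

/-- The semiring `ℕ` as a structure for the language of rings. -/
instance natStructure : ringLanguage.Structure ℕ where
  funMap := fun {_} f =>
    match f with
    | .add => fun x => x 0 + x 1
    | .mul => fun x => x 0 * x 1
    | .zero => fun _ => 0
    | .one => fun _ => 1
  RelMap := fun r => r.elim

instance : IsStandard ℕ :=
  ⟨fun _ => rfl, fun _ => rfl, fun _ => rfl, fun _ => rfl⟩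

section Terms

variable {R : Type*} [Semiring R] [ringLanguage.Structure R] [IsStandard R] {A : Set R}
  {α : Type*} {f g : (α → R) → R}

@[fun_prop]
theorem definableFun_add (hf : A.DefinableFun ringLanguage f) (hg : A.DefinableFun ringLanguage g) :
    A.DefinableFun ringLanguage fun v => f v + g v := by
  simpa [IsStandard.funMap_add] using
    definableFun_funMap (L := ringLanguage) (A := A) RingSymbol.add (f := ![f, g])
      (by simp [Fin.forall_fin_two, hf, hg])

@[fun_prop]
theorem definableFun_mul (hf : A.DefinableFun ringLanguage f) (hg : A.DefinableFun ringLanguage g) :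
    A.DefinableFun ringLanguage fun v => f v * g v := by
  simpa [IsStandard.funMap_mul] using
    definableFun_funMap (L := ringLanguage) (A := A) RingSymbol.mul (f := ![f, g])
      (by simp [Fin.forall_fin_two, hf, hg])

@[fun_prop]
theorem definableFun_zero : A.DefinableFun ringLanguage fun _ : α → R => 0 := by
  simpa only [IsStandard.funMap_zero] using
    definableFun_funMap (L := ringLanguage) (A := A) (M := R) (α := α) RingSymbol.zero
      (f := Fin.elim0) (by simp)

@[fun_prop]
theorem definableFun_one : A.DefinableFun ringLanguage fun _ : α → R => 1 := by
  simpa only [IsStandard.funMap_one] using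
    definableFun_funMap (L := ringLanguage) (A := A) (M := R) (α := α) RingSymbol.one
      (f := Fin.elim0) (by simp)

@[fun_prop]
theorem definableFun_natCast (n : ℕ) : A.DefinableFun ringLanguage fun _ : α → R => (n : R) := by
  induction n with
  | zero => simpa using definableFun_zero
  | succ n ih => simpa using definableFun_add ih definableFun_one

@[fun_prop]
theorem definablePred_isSquare (hf : A.DefinableFun ringLanguage f) :
    DefinablePred ringLanguage A fun v => IsSquare (f v) := by
  have : DefinablePred ringLanguage A fun v : Unit → R => ∃ z, v () = z * z := by fun_prop
  exact this.comp (f := fun _ => f) fun _ => hf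

@[fun_prop]
theorem definablePred_dvd (hf : A.DefinableFun ringLanguage f)
    (hg : A.DefinableFun ringLanguage g) : DefinablePred ringLanguage A fun v => f v ∣ g v := by
  have : DefinablePred ringLanguage A fun v : Fin 2 → R => ∃ z, v 1 = v 0 * z := by fun_prop
  exact this.comp₂ (r := fun x y => x ∣ y) hf hg

@[fun_prop]
theorem definableFun_sub {R : Type*} [Ring R] [ringLanguage.Structure R] [IsStandard R] {A : Set R}
    {f g : (α → R) → R} (hf : A.DefinableFun ringLanguage f)
    (hg : A.DefinableFun ringLanguage g) : A.DefinableFun ringLanguage fun v => f v - g v := by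
  refine definableFun_comp₂ (F := fun x y => x - y) ?_ hf hg
  have : DefinablePred ringLanguage A fun v : Fin 3 → R => v 2 + v 1 = v 0 := by fun_prop
  exact this.congr fun v => eq_sub_iff_add_eq.symm

end Terms

section Arithmetic

variable {A : Set ℕ} {α : Type*} {f g : (α → ℕ) → ℕ}

@[fun_prop]
theorem definablePred_lt (hf : A.DefinableFun ringLanguage f)
    (hg : A.DefinableFun ringLanguage g) :
    DefinablePred ringLanguage A fun v => f v < g v := by
  refine DefinablePred.comp₂ ?_ hf hg
  have : DefinablePred ringLanguage A fun v : Fin 2 → ℕ => ∃ k, v 1 = v 0 + 1 + k := by fun_prop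
  simpa only [Nat.lt_iff_add_one_le, le_iff_exists_add]

@[fun_prop]
theorem definableFun_natPair (hf : A.DefinableFun ringLanguage f)
    (hg : A.DefinableFun ringLanguage g) :
    A.DefinableFun ringLanguage fun v => Nat.pair (f v) (g v) :=
  .ite (definablePred_lt hf hg) (by fun_prop) (by fun_prop)

@[fun_prop]
theorem definableFun_unpair_fst (hf : A.DefinableFun ringLanguage f) :
    A.DefinableFun ringLanguage fun v => (Nat.unpair (f v)).1 := by
  refine definableFun_comp₁ (F := fun n => n.unpair.1) ?_ hf
  have : DefinablePred ringLanguage A fun v : Fin 2 → ℕ => ∃ y, v 0 = Nat.pair (v 1) y := by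
    fun_prop
  exact this.congr fun v => ⟨fun ⟨y, hy⟩ => by simp [hy], fun h => ⟨_, by rw [h, Nat.pair_unpair]⟩⟩

@[fun_prop]
theorem definableFun_unpair_snd (hf : A.DefinableFun ringLanguage f) :
    A.DefinableFun ringLanguage fun v => (Nat.unpair (f v)).2 := by
  refine definableFun_comp₁ (F := fun n => n.unpair.2) ?_ hf
  have : DefinablePred ringLanguage A fun v : Fin 2 → ℕ => ∃ y, v 0 = Nat.pair y (v 1) := by
    fun_prop
  exact this.congr fun v => ⟨fun ⟨y, hy⟩ => by simp [hy], fun h => ⟨_, by rw [h, Nat.pair_unpair]⟩⟩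

@[fun_prop]
theorem definableFun_mod (hf : A.DefinableFun ringLanguage f)
    (hg : A.DefinableFun ringLanguage g) :
    A.DefinableFun ringLanguage fun v => f v % g v := by
  refine definableFun_comp₂ (F := fun m n => m % n) ?_ hf hg
  have : DefinablePred ringLanguage A fun v : Fin 3 → ℕ =>
      v 1 = 0 ∧ v 2 = v 0 ∨ v 2 < v 1 ∧ ∃ q, v 0 = v 2 + v 1 * q := by
    fun_prop
  refine this.congr fun v => ⟨?_, fun h => ?_⟩
  · rintro (⟨h, h'⟩ | ⟨h, q, hq⟩)
    · simp [h, h']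
    · rw [hq, Nat.add_mul_mod_self_left, Nat.mod_eq_of_lt h]
  · rcases Nat.eq_zero_or_pos (v 1) with h0 | h0
    · exact .inl ⟨h0, by simpa [h0] using h⟩
    · exact .inr ⟨h ▸ Nat.mod_lt _ h0, v 0 / v 1, h ▸ (Nat.mod_add_div _ _).symm⟩

@[fun_prop]
theorem definableFun_natBeta (hf : A.DefinableFun ringLanguage f)
    (hg : A.DefinableFun ringLanguage g) :
    A.DefinableFun ringLanguage fun v => Nat.beta (f v) (g v) := by
  unfold Nat.beta
  fun_prop

variable {F G : ℕ → Part ℕ}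

theorem definableGraph_natPair (hF : DefinableGraph ringLanguage A F)
    (hG : DefinableGraph ringLanguage A G) :
    DefinableGraph ringLanguage A fun n => Nat.pair <$> F n <*> G n := by
  have : DefinablePred ringLanguage A fun v : Fin 2 → ℕ =>
      ∃ x, x ∈ F (v 0) ∧ ∃ y, y ∈ G (v 0) ∧ v 1 = Nat.pair x y := by fun_prop
  exact this.congr fun v => by simp [Seq.seq, eq_comm]

theorem exists_beta_eq (s : ℕ → ℕ) (n : ℕ) : ∃ c, ∀ i ≤ n, Nat.beta c i = s i := by
  refine ⟨Nat.unbeta ((List.range (n + 1)).map s), fun i hi => ?_⟩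
  have := Nat.beta_unbeta_coe ((List.range (n + 1)).map s) ⟨i, by simp; omega⟩
  simpa using this

theorem definableGraph_bind (hF : DefinableGraph ringLanguage A F)
    (hG : DefinableGraph ringLanguage A G) :
    DefinableGraph ringLanguage A fun n => G n >>= F := by
  have : DefinablePred ringLanguage A fun v : Fin 2 → ℕ => ∃ x, x ∈ G (v 0) ∧ v 1 ∈ F x := by
    fun_prop
  exact this.congr fun v => Part.mem_bind_iff.symm

theorem definableGraph_rfind (hF : DefinableGraph ringLanguage A F) :
    DefinableGraph ringLanguage A fun a =>
      Nat.rfind fun n => (fun m => m = 0) <$> F (Nat.pair a n) := by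
  have : DefinablePred ringLanguage A fun v : Fin 2 → ℕ => 0 ∈ F (Nat.pair (v 0) (v 1)) ∧
      ∀ k, k < v 1 → ∃ y, y + 1 ∈ F (Nat.pair (v 0) k) := by fun_prop
  refine this.congr fun v => Iff.trans ?_ Nat.mem_rfind.symm
  simp only [Part.map_eq_map, Part.mem_map_iff, decide_eq_true_eq, decide_eq_false_iff_not,
    exists_eq_right]
  refine and_congr_right fun _ => ⟨fun h m hm => ?_, fun h k hk => ?_⟩
  · obtain ⟨y, hy⟩ := h m hm
    exact ⟨y + 1, hy, y.succ_ne_zero⟩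
  · obtain ⟨z, hz, hz0⟩ := h hk
    obtain ⟨y, rfl⟩ := Nat.exists_eq_succ_of_ne_zero hz0
    exact ⟨y, hz⟩

theorem mem_rec_bind_iff {α : Type*} {p : Part α} {g : ℕ → α → Part α} {n : ℕ} {x : α} :
    x ∈ (n.rec p fun k q => q.bind (g k) : Part α) ↔
      ∃ s : ℕ → α, s 0 ∈ p ∧ (∀ k < n, s (k + 1) ∈ g k (s k)) ∧ x = s n := by
  induction n generalizing x with
  | zero => exact ⟨fun h => ⟨fun _ => x, h, by simp, rfl⟩, by rintro ⟨s, h, -, rfl⟩; exact h⟩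
  | succ n ih =>
    refine Part.mem_bind_iff.trans ⟨?_, ?_⟩
    · rintro ⟨y, hy, hx⟩
      obtain ⟨s, h0, hs, rfl⟩ := ih.1 hy
      refine ⟨Function.update s (n + 1) x, by simpa using h0, fun k hk => ?_, by simp⟩
      rcases Nat.lt_succ_iff_lt_or_eq.1 hk with hk | rfl
      · simpa [hk.ne, (hk.trans n.lt_succ_self).ne] using hs k hk
      · simpa using hx
    · rintro ⟨s, h0, hs, rfl⟩
      exact ⟨s n, ih.2 ⟨s, h0, fun k hk => hs k (hk.trans n.lt_succ_self), rfl⟩,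
        hs n n.lt_succ_self⟩

theorem definableGraph_prec (hF : DefinableGraph ringLanguage A F)
    (hG : DefinableGraph ringLanguage A G) :
    DefinableGraph ringLanguage A (Nat.unpaired fun a n =>
      n.rec (F a) fun y IH => do let i ← IH; G (Nat.pair a (Nat.pair y i))) := by
  have : DefinablePred ringLanguage A fun v : Fin 2 → ℕ => ∃ c,
      Nat.beta c 0 ∈ F (v 0).unpair.1 ∧
      (∀ k, k < (v 0).unpair.2 → Nat.beta c (k + 1) ∈
          G (Nat.pair (v 0).unpair.1 (Nat.pair k (Nat.beta c k)))) ∧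
        v 1 = Nat.beta c (v 0).unpair.2 := by fun_prop
  refine this.congr fun v => Iff.trans ⟨?_, ?_⟩ mem_rec_bind_iff.symm
  · rintro ⟨c, h⟩
    exact ⟨_, h⟩
  · rintro ⟨s, h0, hs, hn⟩
    obtain ⟨c, hc⟩ := exists_beta_eq s (v 0).unpair.2
    refine ⟨c, by rwa [hc 0 (Nat.zero_le _)], fun k hk => ?_, by rwa [hc _ le_rfl]⟩
    rw [hc k hk.le, hc (k + 1) hk]
    exact hs k hk

theorem definableGraph_of_partrec {F : ℕ →. ℕ} (hF : Nat.Partrec F) :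
    DefinableGraph ringLanguage A F := by
  induction hF with
  | zero =>
    have : DefinablePred ringLanguage A fun v : Fin 2 → ℕ => v 1 = 0 := by fun_prop
    exact this.congr fun v => by simp [pure, PFun.pure]
  | succ =>
    have : DefinablePred ringLanguage A fun v : Fin 2 → ℕ => v 1 = v 0 + 1 := by fun_prop
    exact this.congr fun v => by simp
  | left =>
    have : DefinablePred ringLanguage A fun v : Fin 2 → ℕ => v 1 = (v 0).unpair.1 := by fun_prop
    exact this.congr fun v => by simp
  | right =>
    have : DefinablePred ringLanguage A fun v : Fin 2 → ℕ => v 1 = (v 0).unpair.2 := by fun_prop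
    exact this.congr fun v => by simp
  | pair _ _ hf hg => exact definableGraph_natPair hf hg
  | comp _ _ hf hg => exact definableGraph_bind hf hg
  | prec _ _ hf hg => exact definableGraph_prec hf hg
  | rfind _ hf => exact definableGraph_rfind hf

end Arithmetic

end ringLanguage

section Relativization

open Language

variable {L : Language} {M N : Type*} [L.Structure M] [L.Structure N] {A : Set N} {α : Type*}

theorem definablePred_relMap {n : ℕ} (r : L.Relations n) {f : Fin n → (α → N) → N}
    (hf : ∀ i, A.DefinableFun L (f i)) :
    DefinablePred L A fun v => Structure.RelMap r fun i => f i v := by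
  have h : (∅ : Set N).Definable L {w | Structure.RelMap r w} :=
    Set.empty_definable_iff.2 ⟨r.formula Term.var, by ext; simp⟩
  exact DefinablePred.comp (h.mono (Set.empty_subset A)) hf

/-- Quantifiers over `M` become quantifiers over `N` relativized to the range of the embedding. -/
theorem exists_definablePred_realize_iff (ι : M ↪[L] N) (hι : A.Definable₁ L (Set.range ι)) {n : ℕ}
    (φ : L.BoundedFormula α n) : ∃ Q : (α ⊕ Fin n → N) → Prop, DefinablePred L A Q ∧
      ∀ v xs, Q (ι ∘ Sum.elim v xs) ↔ φ.Realize v xs := by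
  induction φ with
  | falsum => exact ⟨fun _ => False, Set.definable_empty, fun _ _ => Iff.rfl⟩
  | equal s t =>
    refine ⟨fun w => s.realize w = t.realize w, by fun_prop, fun v xs => ?_⟩
    simp only [HomClass.realize_term, ι.injective.eq_iff]
    rfl
  | rel r ts =>
    refine ⟨fun w => Structure.RelMap r fun i => (ts i).realize w,
      definablePred_relMap r fun i => by fun_prop, fun v xs => ?_⟩
    simp only [HomClass.realize_term]
    exact ι.map_rel r _
  | imp _ _ ihφ ihψ =>
    obtain ⟨P, hP, hPφ⟩ := ihφ
    obtain ⟨Q, hQ, hQψ⟩ := ihψ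
    exact ⟨_, hP.imp hQ, fun v xs => imp_congr (hPφ v xs) (hQψ v xs)⟩
  | @all n φ ih =>
    obtain ⟨Q, hQ, hQφ⟩ := ih
    let e : α ⊕ Fin (n + 1) → Option (α ⊕ Fin n) :=
      Sum.elim (some ∘ .inl) (Fin.snoc (some ∘ .inr) none)
    refine ⟨fun w => ∀ y, y ∈ Set.range ι → Q fun a => (e a).elim y w, .all (.imp ?_ ?_),
      fun v xs => ?_⟩
    · exact .mem_of_definable₁ hι (by fun_prop)
    · refine (hQ.reindex e).congr fun w => iff_of_eq (congrArg Q (funext fun a => ?_))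
      cases h : e a <;> simp [h]
    · simp only [Set.forall_mem_range, BoundedFormula.realize_all, ← hQφ]
      refine forall_congr' fun x => iff_of_eq (congrArg Q (funext fun a => ?_))
      rcases a with a | i
      · simp [e]
      · induction i using Fin.lastCases <;> simp [e]

theorem DefinablePred.exists_comp_embedding (ι : M ↪[L] N) (hι : A.Definable₁ L (Set.range ι))
    {P : (α → M) → Prop} (hP : DefinablePred L ∅ P) :
    ∃ Q : (α → N) → Prop, DefinablePred L A Q ∧ ∀ v, Q (ι ∘ v) ↔ P v := by
  obtain ⟨φ, hφ⟩ := Set.empty_definable_iff.1 hP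
  obtain ⟨Q, hQ, hQφ⟩ := exists_definablePred_realize_iff ι hι φ
  refine ⟨_, hQ.reindex (Sum.elim id finZeroElim), fun v => ?_⟩
  have hv : (ι ∘ v) ∘ Sum.elim id finZeroElim = ι ∘ Sum.elim v default := by
    ext (a | i)
    · rfl
    · exact i.elim0
  rw [hv, hQφ]
  exact (Set.ext_iff.1 hφ v).symm

end Relativization

namespace ringLanguage

theorem definablePred_of_rePred {A : Set ℕ} {p : ℕ → Prop} (hp : REPred p) :
    DefinablePred ringLanguage A fun v : Fin 1 → ℕ => p (v 0) := by
  let F (n : ℕ) : Part ℕ := (Part.assert (p n) fun _ => Part.some ()).map fun _ => 0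
  have hF : DefinableGraph ringLanguage A F :=
    definableGraph_of_partrec (Partrec.nat_iff.1 (hp.map (Computable.const 0).to₂))
  have : DefinablePred ringLanguage A fun v : Fin 1 → ℕ => ∃ y, y ∈ F (v 0) := by fun_prop
  exact this.congr fun v => by simp [F]

section Undecidability

variable {R : Type*} [Semiring R] [ringLanguage.Structure R] [IsStandard R]

/-- The inclusion of `ℕ` into a semiring of characteristic zero, as a morphism of structures. -/
def natCastEmbedding (R : Type*) [Semiring R] [CharZero R] [ringLanguage.Structure R]
    [IsStandard R] : ℕ ↪[ringLanguage] R where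
  toFun := Nat.cast
  inj' := Nat.cast_injective
  map_fun' := fun {_} f x => by
    change RingSymbol _ at f
    cases f <;> simp [IsStandard.funMap_add, IsStandard.funMap_mul, IsStandard.funMap_zero,
      IsStandard.funMap_one]
  map_rel' := fun r => r.elim

/-- The term `((0 + 1) + ⋯) + 1` with `n` summands `1`. -/
def numeral : ℕ → ringLanguage.Term (Empty ⊕ Fin 1)
  | 0 => .func (l := 0) RingSymbol.zero Fin.elim0
  | n + 1 => .func (l := 2) RingSymbol.add
      ![numeral n, .func (l := 0) RingSymbol.one Fin.elim0]

theorem realize_numeral (n : ℕ) (v : Empty ⊕ Fin 1 → R) : (numeral n).realize v = n := by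
  induction n with
  | zero => exact (IsStandard.funMap_zero _).trans Nat.cast_zero.symm
  | succ n ih =>
    rw [Nat.cast_succ, ← ih]
    exact (IsStandard.funMap_add _).trans (congrArg _ (IsStandard.funMap_one _))

theorem primrec_termCode_numeral : Primrec fun n => termCode (numeral n) := by
  have : (fun n => termCode (numeral n)) = fun n => Nat.rec (Nat.pair 1 0)
      (fun _ c => Nat.pair 3 (Nat.pair c (Nat.pair 2 0))) n := by
    funext n
    induction n with
    | zero => rfl
    | succ n ih => simp only [← ih]; rfl
  rw [this]
  exact Primrec.nat_rec₁ _ (Primrec₂.natPair.comp (Primrec.const 3)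
    (Primrec₂.natPair.comp Primrec.snd (Primrec.const _))).to₂

/-- The sentence stating that `φ` holds of the natural number `n`, in the form
`∀ x, x = n → φ x`, which avoids substitution into `φ`. -/
def instanceSentence (φ : ringLanguage.BoundedFormula Empty 1) (n : ℕ) : ringLanguage.Sentence :=
  .all (.imp (.equal (.var (.inr 0)) (numeral n)) φ)

theorem primrec_godelNumber_instanceSentence (φ : ringLanguage.BoundedFormula Empty 1) :
    Primrec fun n => godelNumber (instanceSentence φ n) := by
  change Primrec fun n => Nat.pair 3 (Nat.pair 2 (Nat.pair (Nat.pair 1 (Nat.pair (Nat.pair 0 0)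
    (termCode (numeral n)))) (formulaCode φ)))
  exact Primrec₂.natPair.comp (.const 3) (Primrec₂.natPair.comp (.const 2) (Primrec₂.natPair.comp
    (Primrec₂.natPair.comp (.const 1) (Primrec₂.natPair.comp (.const _) primrec_termCode_numeral))
    (.const _)))

theorem realize_instanceSentence (φ : ringLanguage.BoundedFormula Empty 1) (n : ℕ) :
    R ⊨ instanceSentence φ n ↔ φ.Realize default fun _ => (n : R) := by
  have h : R ⊨ instanceSentence φ n ↔ ∀ x : R, x = n → φ.Realize default fun _ => x := by
    refine forall_congr' fun x => imp_congr ?_ ?_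
    · rw [← realize_numeral n (Sum.elim default (Fin.snoc default x))]
      rfl
    · exact iff_of_eq (congrArg _ (funext fun i => by fin_cases i; rfl))
  rw [h, forall_eq]

theorem exists_primrec_realize_iff {Q : (Fin 1 → R) → Prop} (hQ : DefinablePred ringLanguage ∅ Q) :
    ∃ s : ℕ → ringLanguage.Sentence, Primrec (fun n => godelNumber (s n)) ∧
      ∀ n, R ⊨ s n ↔ Q fun _ => n := by
  obtain ⟨φ, hφ⟩ := Set.empty_definable_iff.1 hQ
  refine ⟨_, primrec_godelNumber_instanceSentence
    (Language.BoundedFormula.relabel (Sum.inr : Fin 1 → Empty ⊕ Fin 1) φ), fun n => ?_⟩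
  rw [realize_instanceSentence, Language.Formula.realize_relabel_sumInr]
  exact (Set.ext_iff.1 hφ _).symm

theorem DecidableTheory.computablePred_mem {S : ringLanguage.Theory} (hS : DecidableTheory S)
    {α : Type*} [Primcodable α] {s : α → ringLanguage.Sentence}
    (hs : Computable fun a => godelNumber (s a)) : ComputablePred fun a => s a ∈ S := by
  classical
  obtain ⟨f, hf, hfS⟩ := hS
  refine ⟨fun a => inferInstance, (hf.comp hs).of_eq_tot fun a => ?_⟩
  by_cases ha : s a ∈ S
  · simpa [ha] using (hfS _).1 ha
  · simpa [ha] using (hfS _).2 ha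

theorem not_decidableTheory_completeTheory [CharZero R]
    (hR : (∅ : Set R).Definable₁ ringLanguage (Set.range Nat.cast)) :
    ¬ DecidableTheory (ringLanguage.completeTheory R) := by
  intro hdec
  let halts (n : ℕ) : Prop := ((Denumerable.ofNat Nat.Partrec.Code n).eval 0).Dom
  have hhalts : REPred halts :=
    (ComputablePred.halting_problem_re 0).comp (Computable.ofNat Nat.Partrec.Code)
  obtain ⟨Q, hQ, hQhalts⟩ :=
    (definablePred_of_rePred hhalts).exists_comp_embedding (natCastEmbedding R) hR
  obtain ⟨s, hs, hsQ⟩ := exists_primrec_realize_iff hQ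
  refine ComputablePred.halting_problem 0 ?_
  refine (hdec.computablePred_mem (hs.to_comp.comp Computable.encode)).of_eq fun c => ?_
  rw [Language.mem_completeTheory, hsQ]
  exact (hQhalts fun _ => Encodable.encode c).trans (by simp [halts])

end Undecidability

end ringLanguage

section Polynomials

open Filter Topology Polynomial

theorem splits_comp_X_sq {K : Type*} [Field K] {p : K[X]} (hp : p.Splits)
    (hroots : ∀ r ∈ p.roots, IsSquare r) : (p.comp (X ^ 2)).Splits := by
  rw [hp.eq_prod_roots, mul_comp, C_comp, multiset_prod_comp, Multiset.map_map]
  refine (Splits.C _).mul (.multisetProd fun q hq => ?_)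
  obtain ⟨r, hr, rfl⟩ := Multiset.mem_map.1 hq
  obtain ⟨s, rfl⟩ := hroots r hr
  have : (X - C (s * s)).comp (X ^ 2) = (X - C s) * (X + C s) := by
    rw [sub_comp, X_comp, C_comp, C_mul]
    ring
  rw [Function.comp_apply, this]
  exact (Splits.X_sub_C s).mul (.X_add_C s)

theorem norm_coeff_zero_lt_one {K : Type*} [NormedField K] {p : K[X]} (hp : p.Splits)
    (hmonic : p.Monic) (hdeg : p.natDegree ≠ 0) (hroots : ∀ r ∈ p.roots, ‖r‖ < 1) :
    ‖p.coeff 0‖ < 1 := by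
  have hcard : p.roots ≠ 0 := fun h => hdeg <| by rw [hp.natDegree_eq_card_roots, h]; rfl
  rw [hp.coeff_zero_eq_prod_roots_of_monic hmonic, norm_mul, norm_pow, norm_neg, norm_one, one_pow,
    one_mul]
  by_cases h0 : 0 ∈ p.roots
  · simp [Multiset.prod_eq_zero h0]
  · calc ‖p.roots.prod‖ = (p.roots.map fun r => ‖r‖).prod := map_multiset_prod normHom p.roots
      _ < (p.roots.map fun _ => 1).prod := Multiset.prod_map_lt_prod_map hcard _ _
          (fun r hr => norm_pos_iff.2 fun h => h0 (h ▸ hr)) hroots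
      _ = 1 := Multiset.prod_map_one

theorem exists_monic_abs_eval_le (a : ℝ) {ρ : ℝ} (hρ : 0 < ρ) (j : ℕ) :
    ∃ P : ℝ[X], P.Monic ∧ P.natDegree = j ∧
      ∀ x ∈ Set.Icc a (a + 4 * ρ), |P.eval x| ≤ 2 * ρ ^ j := by
  rcases j with - | k
  · exact ⟨1, monic_one, natDegree_one, fun x _ => by simp⟩
  let ℓ : ℝ[X] := C (2 * ρ)⁻¹ * X + C (-(2 * ρ)⁻¹ * a - 1)
  have hlead : ℓ.leadingCoeff = (2 * ρ)⁻¹ := leadingCoeff_linear (by positivity)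
  have hdeg : ℓ.natDegree = 1 := natDegree_linear (by positivity)
  refine ⟨C (2 * ρ ^ (k + 1)) * (Chebyshev.T ℝ ((k + 1 : ℕ) : ℤ)).comp ℓ, ?_, ?_, fun x hx => ?_⟩
  · rw [Monic, leadingCoeff_mul, leadingCoeff_C, leadingCoeff_comp (by simp [hdeg]), hlead,
      Chebyshev.leadingCoeff_T, Chebyshev.natDegree_T, Int.natAbs_natCast]
    simp only [pow_succ, add_tsub_cancel_right, mul_inv_rev, mul_pow, inv_pow]
    field_simp
  · rw [natDegree_C_mul (by positivity), natDegree_comp, hdeg, Chebyshev.natDegree_T, mul_one,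
      Int.natAbs_natCast]
  · have hx' : |ℓ.eval x| ≤ 1 := by
      have : ℓ.eval x = (x - a) / (2 * ρ) - 1 := by
        simp only [ℓ, eval_add, eval_mul, eval_C, eval_X]
        ring
      rw [this, abs_le, le_sub_iff_add_le, sub_le_iff_le_add, le_div_iff₀ (by positivity),
        div_le_iff₀ (by positivity)]
      constructor <;> linarith [hx.1, hx.2]
    rw [eval_mul, eval_C, abs_mul, abs_of_pos (by positivity), eval_comp]
    exact mul_le_of_le_one_right (by positivity) (Chebyshev.abs_eval_T_real_le_one _ hx')

theorem sum_range_add_single_smul {R M : Type*} [Semiring R] [AddCommMonoid M] [Module R M]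
    (c : ℕ → R) (n : ℕ) (r : R) (v : ℕ → M) :
    ∑ j ∈ Finset.range (n + 1), (c + Pi.single n r : ℕ → R) j • v j =
      ∑ j ∈ Finset.range (n + 1), c j • v j + r • v n := by
  simp [add_smul, Finset.sum_add_distrib, Pi.single_apply, ite_smul]

theorem exists_map_intCast_eq_add_sum {P : ℕ → ℝ[X]} (hP : ∀ j, (P j).Monic)
    (hdeg : ∀ j, (P j).natDegree = j) (n : ℕ) (g : ℝ[X]) (hg : g.degree < n) :
    ∃ (h : ℤ[X]) (c : ℕ → ℝ), h.degree < n ∧ (∀ j, c j ∈ Set.Icc 0 1) ∧ (∀ j ≥ n, c j = 0) ∧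
      h.map (Int.castRingHom ℝ) = g + ∑ j ∈ Finset.range n, c j • P j := by
  induction n generalizing g with
  | zero =>
    obtain rfl : g = 0 := by simpa using hg
    exact ⟨0, 0, by simp, by simp, by simp, by simp⟩
  | succ n ih =>
    let a := g.coeff n
    have hlt : (g + (⌈a⌉ - a) • P n - (⌈a⌉ : ℝ) • X ^ n).degree < (n : WithBot ℕ) := by
      rw [degree_lt_iff_coeff_zero]
      intro m hm
      simp only [coeff_sub, coeff_add, coeff_smul, smul_eq_mul, coeff_X_pow]
      rcases hm.eq_or_lt with rfl | hm
      · have hPn : (P n).coeff n = 1 := by simpa only [hdeg] using (hP n).coeff_natDegree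
        rw [hPn, if_pos rfl]
        ring
      · rw [coeff_eq_zero_of_natDegree_lt ((hdeg n).trans_lt hm),
          (degree_lt_iff_coeff_zero g _).1 hg m hm, if_neg hm.ne']
        ring
    obtain ⟨h, c, hh, hc, hc0, he⟩ := ih _ hlt
    have hn : (n : WithBot ℕ) < (n + 1 : ℕ) := by exact_mod_cast n.lt_succ_self
    refine ⟨h + C ⌈a⌉ * X ^ n, c + Pi.single n (⌈a⌉ - a), ?_, fun j => ?_, fun j hj => ?_, ?_⟩
    · exact (degree_add_le _ _).trans_lt
        (max_lt (hh.trans hn) ((degree_C_mul_X_pow_le _ _).trans_lt hn))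
    · rcases eq_or_ne j n with rfl | hj
      · simp [hc0 j le_rfl, Int.le_ceil, (Int.ceil_lt_add_one a).le, add_comm 1 a]
      · simpa [hj] using hc j
    · simp [hc0 j (Nat.le_of_succ_le hj), (Nat.lt_of_succ_le hj).ne']
    · rw [sum_range_add_single_smul]
      rw [Polynomial.map_add, Polynomial.map_mul, Polynomial.map_pow, map_C, map_X, he,
        Finset.sum_range_succ, hc0 n le_rfl, zero_smul, ← smul_eq_C_mul, eq_intCast]
      abel

theorem exists_natDegree_eq_map_intCast_eq_sum {P : ℕ → ℝ[X]} (hP : ∀ j, (P j).Monic)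
    (hdeg : ∀ j, (P j).natDegree = j) (n : ℕ) :
    ∃ (F : ℤ[X]) (c : ℕ → ℝ), F.natDegree = n ∧ (∀ j, c j ∈ Set.Icc 0 1) ∧ (∀ j > n, c j = 0) ∧
      F.map (Int.castRingHom ℝ) = ∑ j ∈ Finset.range (n + 1), c j • P j := by
  have hlt : (P n - X ^ n).degree < (n : WithBot ℕ) := by
    have := degree_sub_lt_left (p := P n) (q := X ^ n)
      (by rw [degree_eq_natDegree (hP n).ne_zero, hdeg, degree_X_pow]) (hP n).ne_zero
      (by rw [(hP n).leadingCoeff, leadingCoeff_X_pow])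
    rwa [degree_eq_natDegree (hP n).ne_zero, hdeg] at this
  obtain ⟨h, c, hh, hc, hc0, he⟩ := exists_map_intCast_eq_add_sum hP hdeg n _ hlt
  refine ⟨X ^ n + h, c + Pi.single n 1, ?_, fun j => ?_, fun j hj => ?_, ?_⟩
  · rw [natDegree_add_eq_left_of_degree_lt (by rwa [degree_X_pow]), natDegree_X_pow]
  · rcases eq_or_ne j n with rfl | hj
    · simp [hc0]
    · simpa [hj] using hc j
  · simp [hc0 j hj.le, hj.ne']
  · rw [sum_range_add_single_smul]
    simp only [Polynomial.map_add, Polynomial.map_pow, map_X, he, Finset.sum_range_succ,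
      hc0 n le_rfl, zero_smul, one_smul]
    ring

theorem exists_ne_hasSum_abs_sub_mul_lt {c : ℕ → ℕ → ℝ} (hc : ∀ k j, c k j ∈ Set.Icc 0 1)
    {b : ℕ → ℝ} (hb : Summable b) {ε : ℝ} (hε : 0 < ε) :
    ∃ k l, k ≠ l ∧ ∃ s < ε, HasSum (fun j => |c k j - c l j| * b j) s := by
  obtain ⟨a, -, φ, hφ, hlim⟩ :=
    (isCompact_univ_pi fun _ : ℕ => isCompact_Icc (a := (0 : ℝ)) (b := 1)).tendsto_subseq
      fun k j _ => hc k j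
  have hdiff (j : ℕ) : Tendsto (fun n => |c (φ n) j - c (φ (n + 1)) j| * b j) atTop (𝓝 0) := by
    have hj := tendsto_pi_nhds.1 hlim j
    simpa using ((hj.sub ((tendsto_add_atTop_iff_nat 1).2 hj)).abs.mul_const (b j))
  have hle (n j : ℕ) : ‖|c (φ n) j - c (φ (n + 1)) j| * b j‖ ≤ ‖b j‖ := by
    rw [norm_mul, norm_abs_eq_norm]
    exact mul_le_of_le_one_left (norm_nonneg _) (Real.dist_le_of_mem_Icc_01 (hc _ _) (hc _ _))
  have hsum := tendsto_tsum_of_dominated_convergence hb.norm hdiff (.of_forall hle)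
  rw [tsum_zero] at hsum
  obtain ⟨n, hn⟩ := (hsum.eventually_lt_const hε).exists
  exact ⟨_, _, (hφ n.lt_succ_self).ne, _, hn, (hb.norm.of_norm_bounded (hle n)).hasSum⟩

theorem exists_int_polynomial_abs_aeval_lt {P : ℕ → ℝ[X]} (hP : ∀ j, (P j).Monic)
    (hdeg : ∀ j, (P j).natDegree = j) {S : Set ℝ} {b : ℕ → ℝ} (hb : Summable b)
    (hPb : ∀ j, ∀ x ∈ S, |(P j).eval x| ≤ b j) {ε : ℝ} (hε : 0 < ε) :
    ∃ f : ℤ[X], f ≠ 0 ∧ ∀ x ∈ S, |f.aeval x| < ε := by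
  choose F c hF hc hc0 hFc using exists_natDegree_eq_map_intCast_eq_sum hP hdeg
  obtain ⟨k, l, hkl, s, hs, hsum⟩ := exists_ne_hasSum_abs_sub_mul_lt hc hb hε
  refine ⟨F k - F l, fun h => hkl ?_, fun x hx => ?_⟩
  · rw [← hF k, sub_eq_zero.1 h, hF]
  have heval (n : ℕ) : HasSum (fun j => c n j * (P j).eval x) (aeval x (F n)) := by
    have : aeval x (F n) = ∑ j ∈ Finset.range (n + 1), c n j * (P j).eval x := by
      rw [aeval_def, algebraMap_int_eq, ← eval_map, hFc]
      simp [eval_finsetSum]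
    rw [this]
    refine hasSum_sum_of_ne_finset_zero fun j hj => ?_
    rw [hc0 n j (by simpa using hj), zero_mul]
  have hle (j : ℕ) : ‖c k j * (P j).eval x - c l j * (P j).eval x‖ ≤ |c k j - c l j| * b j := by
    rw [← sub_mul, norm_mul]
    exact mul_le_mul_of_nonneg_left (hPb j x hx) (abs_nonneg _)
  rw [map_sub, ← ((heval k).sub (heval l)).tsum_eq]
  exact (tsum_of_norm_bounded hsum hle).trans_lt hs

theorem exists_int_polynomial_abs_aeval_lt_of_sub_lt_four {a b : ℝ} (hab : b - a < 4) {ε : ℝ}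
    (hε : 0 < ε) : ∃ f : ℤ[X], f ≠ 0 ∧ ∀ x ∈ Set.Icc a b, |f.aeval x| < ε := by
  obtain ⟨ρ, hρ, hρ1⟩ := exists_between (max_lt one_pos (by linarith : (b - a) / 4 < 1))
  obtain ⟨hρ0, hρ⟩ := max_lt_iff.1 hρ
  choose P hP hdeg hPρ using exists_monic_abs_eval_le a hρ0
  obtain ⟨f, hf0, hf⟩ := exists_int_polynomial_abs_aeval_lt hP hdeg
    ((summable_geometric_of_lt_one hρ0.le hρ1).mul_left 2) hPρ hε
  exact ⟨f, hf0, fun x hx => hf x ⟨hx.1, by linarith [hx.2]⟩⟩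

end Polynomials

local notation "𝕋" => totallyRealNumbers

namespace totallyRealNumbers

open Polynomial

instance : IsGalois ℚ 𝕋 := totallyRealNumbers_isGreatest.1

section Embeddings

theorem splits_map_minpoly (t : 𝕋) : ((minpoly ℚ t).map (algebraMap ℚ ℝ)).Splits := by
  have h := (Normal.splits (F := ℚ) (K := 𝕋) inferInstance t).map (algebraMap 𝕋 ℝ)
  rwa [Polynomial.map_map, ← IsScalarTower.algebraMap_eq] at h

theorem range_embedding_eq_rootSet (t : 𝕋) :
    (Set.range fun σ : 𝕋 →+* ℝ => σ t) = (minpoly ℚ t).rootSet ℝ := by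
  rw [← Algebra.IsAlgebraic.range_eval_eq_rootSet_minpoly_of_splits ℝ splits_map_minpoly t]
  ext r
  exact ⟨fun ⟨σ, hσ⟩ => ⟨σ.toRatAlgHom, hσ⟩, fun ⟨σ, hσ⟩ => ⟨σ, hσ⟩⟩

theorem mem_aroots_minpoly {t : 𝕋} {r : ℝ} :
    r ∈ (minpoly ℚ t).aroots ℝ ↔ ∃ σ : 𝕋 →+* ℝ, σ t = r := by
  rw [← Multiset.mem_toFinset, ← Finset.mem_coe, ← rootSet_def, ← range_embedding_eq_rootSet]
  rfl

theorem exists_max_embedding (t : 𝕋) : ∃ σ₀ : 𝕋 →+* ℝ, ∀ σ : 𝕋 →+* ℝ, σ t ≤ σ₀ t := by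
  have hfin : (Set.range fun σ : 𝕋 →+* ℝ => σ t).Finite :=
    range_embedding_eq_rootSet t ▸ rootSet_finite _ _
  obtain ⟨_, ⟨σ₀, rfl⟩, h⟩ := Set.exists_max_image _ id hfin ⟨_, algebraMap 𝕋 ℝ, rfl⟩
  exact ⟨σ₀, fun σ => h _ ⟨σ, rfl⟩⟩

theorem eq_zero_of_abs_embedding_lt_one {q : 𝓞 𝕋} (hq : ∀ σ : 𝕋 →+* ℝ, |σ q| < 1) : q = 0 := by
  have hi : IsIntegral ℚ (q : 𝕋) := Algebra.IsIntegral.isIntegral _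
  have hlt := norm_coeff_zero_lt_one (splits_map_minpoly (q : 𝕋)) ((minpoly.monic hi).map _)
    (by rw [natDegree_map]; exact (minpoly.natDegree_pos hi).ne') fun r hr => by
      obtain ⟨σ, rfl⟩ := mem_aroots_minpoly.1 hr
      exact hq σ
  have hmap := minpoly.isIntegrallyClosed_eq_field_fractions' ℚ q.isIntegral_coe
  rw [hmap, Polynomial.map_map, coeff_map, eq_intCast, Int.norm_cast_real, Int.norm_eq_abs] at hlt
  have hcoeff : (minpoly ℤ (q : 𝕋)).coeff 0 = 0 := Int.abs_lt_one_iff.1 (by exact_mod_cast hlt)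
  exact RingOfIntegers.ext <| (minpoly.coeff_zero_eq_zero hi).1 <| by
    rw [hmap, coeff_map, hcoeff, map_zero]

theorem mem_of_splits {p : ℚ[X]} (hp : (p.map (algebraMap ℚ ℝ)).Splits) {r : ℝ}
    (hr : r ∈ p.rootSet ℝ) : r ∈ 𝕋 := by
  have := IntermediateField.adjoin_rootSet_isSplittingField hp
  have hn : Normal ℚ (IntermediateField.adjoin ℚ (p.rootSet ℝ)) :=
    Normal.of_isSplittingField (hFEp := this)
  have hg : IsGalois ℚ (IntermediateField.adjoin ℚ (p.rootSet ℝ)) := ⟨⟩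
  exact totallyRealNumbers_isGreatest.2 hg (IntermediateField.subset_adjoin _ _ hr)

theorem sqrt_mem {t : 𝕋} (ht : ∀ σ : 𝕋 →+* ℝ, 0 ≤ σ t) : √(t : ℝ) ∈ 𝕋 := by
  have hm := minpoly.monic (Algebra.IsIntegral.isIntegral (R := ℚ) t)
  have hroots : ∀ r ∈ (minpoly ℚ t).aroots ℝ, IsSquare r := fun r hr => by
    obtain ⟨σ, rfl⟩ := mem_aroots_minpoly.1 hr
    exact Real.isSquare_iff.2 (ht σ)
  refine mem_of_splits (p := (minpoly ℚ t).comp (X ^ 2)) ?_ (mem_rootSet.2 ⟨?_, ?_⟩)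
  · rw [map_comp, Polynomial.map_pow, map_X]
    exact splits_comp_X_sq (splits_map_minpoly t) hroots
  · exact (hm.comp (monic_X_pow 2) (by simp)).ne_zero
  · have hsq : √(t : ℝ) ^ 2 = algebraMap 𝕋 ℝ t := Real.sq_sqrt (ht (algebraMap 𝕋 ℝ))
    rw [aeval_comp, map_pow, aeval_X, hsq, aeval_algebraMap_apply, minpoly.aeval, map_zero]

theorem isSquare_iff {t : 𝓞 𝕋} : IsSquare t ↔ ∀ σ : 𝕋 →+* ℝ, 0 ≤ σ t := by
  constructor
  · rintro ⟨x, rfl⟩ σ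
    simpa using mul_self_nonneg (σ x)
  · intro ht
    let y : 𝕋 := ⟨√((t : 𝕋) : ℝ), sqrt_mem ht⟩
    have hy : t = y * y := Subtype.ext (Real.mul_self_sqrt (ht (algebraMap 𝕋 ℝ))).symm
    have hyi : IsIntegral ℤ y := .of_pow two_pos (by rw [sq, ← hy]; exact t.2)
    exact ⟨⟨y, hyi⟩, RingOfIntegers.ext hy⟩

end Embeddings

section Kronecker

theorem finite_setOf_forall_embedding_mem_Icc {a b : ℝ} (hab : b - a < 4) :
    {t : 𝓞 𝕋 | ∀ σ : 𝕋 →+* ℝ, σ t ∈ Set.Icc a b}.Finite := by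
  obtain ⟨f, hf0, hf⟩ := exists_int_polynomial_abs_aeval_lt_of_sub_lt_four hab one_pos
  refine (f.rootSet_finite (𝓞 𝕋)).subset fun t ht => mem_rootSet.2 ⟨hf0, ?_⟩
  refine eq_zero_of_abs_embedding_lt_one fun σ => ?_
  have hσ : aeval (σ t) f = σ (aeval t f : 𝓞 𝕋) :=
    aeval_algHom_apply (σ.comp (algebraMap (𝓞 𝕋) 𝕋)).toIntAlgHom t f
  exact hσ ▸ hf _ (ht σ)

theorem finite_setOf_embedding_lt_four {M : ℝ} (hM : M < 4) :
    {t : 𝓞 𝕋 | ∀ σ : 𝕋 →+* ℝ, 0 < σ t ∧ σ t < M}.Finite :=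
  (finite_setOf_forall_embedding_mem_Icc (a := 0) (b := M) (by rwa [sub_zero])).subset
    fun _ ht σ => ⟨(ht σ).1.le, (ht σ).2.le⟩

theorem infinite_setOf_embedding_lt_four :
    {t : 𝓞 𝕋 | ∀ σ : 𝕋 →+* ℝ, 0 < σ t ∧ σ t < 4}.Infinite := by
  intro hfin
  obtain ⟨t, ht, hmax⟩ := Set.exists_max_image _ (fun t : 𝓞 𝕋 => algebraMap 𝕋 ℝ t) hfin
    ⟨1, fun σ => by simp⟩
  obtain ⟨x, hx⟩ := isSquare_iff.2 fun σ => (ht σ).1.le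
  have hsq (σ : 𝕋 →+* ℝ) : σ t = |σ x| ^ 2 := by simp [hx, sq]
  have habs (σ : 𝕋 →+* ℝ) : |σ x| < 2 :=
    lt_of_pow_lt_pow_left₀ 2 zero_le_two (by linarith [(ht σ).2, hsq σ])
  wlog hx0 : 0 ≤ algebraMap 𝕋 ℝ x generalizing x
  · exact this (-x) (by rw [neg_mul_neg, hx]) (by simpa using hsq) (by simpa using habs)
      (by simpa using (not_le.1 hx0).le)
  have hle := hmax (2 + x) fun σ => by
    obtain ⟨h1, h2⟩ := abs_lt.1 (habs σ)
    simp only [map_add, map_ofNat]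
    constructor <;> linarith
  have h2 := habs (algebraMap 𝕋 ℝ)
  simp only [map_add, map_ofNat, hsq] at hle
  rw [abs_of_nonneg hx0] at h2 hle
  nlinarith

theorem isLeast_four : IsLeast {M : ℝ | {t : 𝓞 𝕋 | ∀ σ : 𝕋 →+* ℝ,
    0 < σ (t : 𝕋) ∧ σ (t : 𝕋) < M}.Infinite} 4 :=
  ⟨infinite_setOf_embedding_lt_four,
    fun _ hM => not_lt.1 fun h => hM (finite_setOf_embedding_lt_four h)⟩

end Kronecker

section Robinson

variable {R : Type*} [CommRing R]

/-- In `𝓞 𝕋`, the relation `σ u ≤ σ v` for all real embeddings `σ`. -/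
def SquareLE (u v : R) : Prop := IsSquare (v - u)

/-- In `𝓞 𝕋`, the relation `σ u < σ v` for all real embeddings `σ`. -/
def SquareLT (u v : R) : Prop := u ≠ v ∧ SquareLE u v

/-- The relation `0 ≪ b s ≪ a`, where `≪` is `SquareLT`. -/
def InBox (a b s : R) : Prop := SquareLT 0 (b * s) ∧ SquareLT (b * s) a

/-- The values between `0` and `B` of `g` modulo the numbers `1 + (1 + s) d`, where `s` is in the
box given by `a` and `b`. -/
def IsResidue (a b d g B v : R) : Prop :=
  SquareLE 0 v ∧ SquareLE v B ∧ ∃ s, InBox a b s ∧ 1 + (1 + s) * d ∣ g - v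

/-- The first-order predicate that defines the natural numbers in `𝓞 𝕋`: `x` is the end of a chain
`0, 1, 2, …` of residues, which is finite because `a / b` is smaller than `4`. -/
def IsNatural (x : R) : Prop :=
  ∃ a b d g B : R, SquareLT 0 b ∧ SquareLT a (4 * b) ∧
    (∀ s, InBox a b s → SquareLT B (1 + (1 + s) * d)) ∧
    IsResidue a b d g B 0 ∧ ∀ v, IsResidue a b d g B v → v = x ∨ IsResidue a b d g B (v + 1)

theorem definable_isNatural : (∅ : Set R).Definable₁ ringLanguage {x | IsNatural x} := by
  have : DefinablePred ringLanguage ∅ fun v : Fin 1 → R => IsNatural (v 0) := by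
    unfold IsNatural IsResidue InBox SquareLT SquareLE
    fun_prop
  exact this

theorem isCoprime_one_add_mul {s t d : R} (h : s - t ∣ d) :
    IsCoprime (1 + (1 + s) * d) (1 + (1 + t) * d) := by
  obtain ⟨k, rfl⟩ := h
  exact ⟨1 + (1 + s) * k * (1 + t), -((1 + s) ^ 2 * k), by ring⟩

theorem exists_forall_dvd_sub {S : Set R} (hS : S.Finite) {m : R → R}
    (hm : S.Pairwise fun s t => IsCoprime (m s) (m t)) (c : R → R) :
    ∃ g, ∀ s ∈ S, m s ∣ g - c s := by
  have := hS.to_subtype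
  obtain ⟨g, hg⟩ := Ideal.exists_forall_sub_mem_ideal (I := fun s : S => Ideal.span {m s})
    (fun s t hst => (Ideal.isCoprime_span_singleton_iff _ _).2
      (hm s.2 t.2 (Subtype.coe_ne_coe.2 hst))) fun s => c s
  exact ⟨g, fun s hs => Ideal.mem_span_singleton.1 (hg ⟨s, hs⟩)⟩

theorem exists_natCast_dvd [IsDomain R] [Algebra.IsAlgebraic ℤ R] {w : R} (hw : w ≠ 0) :
    ∃ m : ℕ, m ≠ 0 ∧ w ∣ m := by
  obtain ⟨y, hy, hwy⟩ := (Algebra.IsAlgebraic.isAlgebraic (R := ℤ) w).exists_nonzero_dvd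
    (mem_nonZeroDivisors_of_ne_zero hw)
  refine ⟨y.natAbs, Int.natAbs_ne_zero.2 hy, hwy.trans ?_⟩
  rw [← Int.cast_natCast]
  exact Int.cast_dvd_cast _ _ (Int.dvd_natAbs_self)

theorem exists_lt_natCast_sub_dvd [IsDomain R] [Algebra.IsAlgebraic ℤ R] {S : Set R}
    (hS : S.Finite) (n : ℕ) : ∃ d : ℕ, n < d ∧ S.Pairwise fun s t => s - t ∣ (d : R) := by
  choose! m hm0 hm using fun (w : R) (hw : w ≠ 0) => exists_natCast_dvd hw
  classical
  let P := hS.toFinset.offDiag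
  have hne {p} (hp : p ∈ P) : p.1 - p.2 ≠ 0 := sub_ne_zero.2 (Finset.mem_offDiag.1 hp).2.2
  refine ⟨(n + 1) * ∏ p ∈ P, m (p.1 - p.2), ?_, fun s hs t ht hst => ?_⟩
  · exact Nat.le_mul_of_pos_right _
      (Finset.prod_pos fun p hp => Nat.pos_of_ne_zero (hm0 _ (hne hp)))
  · have hp : (s, t) ∈ P := by simp [P, hs, ht, hst]
    exact (hm _ (hne hp)).trans
      (Nat.cast_dvd_cast ((Finset.dvd_prod_of_mem (fun p => m (p.1 - p.2)) hp).mul_left _))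

theorem squareLE_iff {u v : 𝓞 𝕋} : SquareLE u v ↔ ∀ σ : 𝕋 →+* ℝ, σ u ≤ σ v := by
  simp [SquareLE, isSquare_iff]

theorem squareLT_iff {u v : 𝓞 𝕋} : SquareLT u v ↔ ∀ σ : 𝕋 →+* ℝ, σ u < σ v := by
  refine ⟨fun ⟨hne, h⟩ σ => (squareLE_iff.1 h σ).lt_of_ne fun hσ => hne ?_, fun h => ⟨?_, ?_⟩⟩
  · exact RingOfIntegers.ext (σ.injective hσ)
  · rintro rfl
    exact lt_irrefl _ (h (algebraMap 𝕋 ℝ))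
  · exact squareLE_iff.2 fun σ => (h σ).le

theorem inBox_iff {a b s : 𝓞 𝕋} :
    InBox a b s ↔ ∀ σ : 𝕋 →+* ℝ, 0 < σ b * σ s ∧ σ b * σ s < σ a := by
  simp [InBox, squareLT_iff, forall_and]

theorem finite_inBox {a b : 𝓞 𝕋} (hb : SquareLT 0 b) (hab : SquareLT a (4 * b)) :
    {s | InBox a b s}.Finite := by
  simp only [squareLT_iff, map_zero, map_mul, map_ofNat] at hb hab
  obtain ⟨σ₀, hσ₀⟩ := exists_max_embedding ((a : 𝕋) / b)
  simp only [map_div₀] at hσ₀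
  refine (finite_setOf_embedding_lt_four ((div_lt_iff₀ (hb σ₀)).2 (hab σ₀))).subset fun s hs σ => ?_
  obtain ⟨h0, h1⟩ := inBox_iff.1 hs σ
  exact ⟨pos_of_mul_pos_right h0 (hb σ).le, ((lt_div_iff₀' (hb σ)).2 h1).trans_le (hσ₀ σ)⟩

theorem eq_of_dvd_sub {u v m B : 𝓞 𝕋} (hu : SquareLE 0 u) (huB : SquareLE u B)
    (hv : SquareLE 0 v) (hvB : SquareLE v B) (hm : SquareLT B m) (h : m ∣ u - v) : u = v := by
  simp only [squareLE_iff, squareLT_iff, map_zero] at hu huB hv hvB hm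
  obtain ⟨q, hq⟩ := h
  suffices q = 0 by rwa [this, mul_zero, sub_eq_zero] at hq
  refine eq_zero_of_abs_embedding_lt_one fun σ => ?_
  have hσ : σ u - σ v = σ m * σ q := by simpa using congrArg (fun x : 𝓞 𝕋 => σ x) hq
  have hlt : |σ u - σ v| < σ m := by
    rw [abs_lt]
    constructor <;> linarith [hu σ, hv σ, huB σ, hvB σ, hm σ]
  have hm0 : 0 < σ m := (abs_nonneg _).trans_lt hlt
  rw [hσ, abs_mul, abs_of_pos hm0] at hlt
  exact lt_of_mul_lt_mul_left (by rwa [mul_one]) hm0.le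

theorem finite_isResidue {a b d g B : 𝓞 𝕋} (hb : SquareLT 0 b) (hab : SquareLT a (4 * b))
    (hd : ∀ s, InBox a b s → SquareLT B (1 + (1 + s) * d)) :
    {v | IsResidue a b d g B v}.Finite := by
  refine ((finite_inBox hb hab).biUnion (t := fun s => {v | SquareLE 0 v ∧ SquareLE v B ∧
    1 + (1 + s) * d ∣ g - v}) fun s hs => Set.Subsingleton.finite ?_).subset ?_
  · rintro u ⟨hu, huB, hgu⟩ v ⟨hv, hvB, hgv⟩
    exact eq_of_dvd_sub hu huB hv hvB (hd s hs) (by simpa using dvd_sub hgv hgu)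
  · rintro v ⟨hv, hvB, s, hs, hgv⟩
    exact Set.mem_biUnion hs ⟨hv, hvB, hgv⟩

theorem mem_range_natCast_of_isNatural {x : 𝓞 𝕋} (hx : IsNatural x) :
    x ∈ Set.range (Nat.cast : ℕ → 𝓞 𝕋) := by
  obtain ⟨a, b, d, g, B, hb, hab, hd, h0, hs⟩ := hx
  by_contra hx
  have h (n : ℕ) : IsResidue a b d g B n := by
    induction n with
    | zero => rwa [Nat.cast_zero]
    | succ n ih =>
      rw [Nat.cast_succ]
      exact (hs _ ih).resolve_left fun h => hx ⟨n, h⟩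
  exact Set.infinite_of_injective_forall_mem Nat.cast_injective h (finite_isResidue hb hab hd)

theorem exists_rat_lt_four (S : Finset (𝓞 𝕋)) (hS : ∀ t ∈ S, ∀ σ : 𝕋 →+* ℝ, σ t < 4) :
    ∃ r : ℚ, r < 4 ∧ ∀ t ∈ S, ∀ σ : 𝕋 →+* ℝ, σ t < r := by
  have hev : ∀ᶠ M in nhdsWithin (4 : ℝ) (Set.Iio 4), ∀ t ∈ S, ∀ σ : 𝕋 →+* ℝ, σ t < M := by
    refine (Filter.eventually_all_finset S).2 fun t ht => ?_
    obtain ⟨σ₀, hσ₀⟩ := exists_max_embedding (t : 𝕋)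
    filter_upwards [Ioo_mem_nhdsLT (hS t ht σ₀)] with M hM σ
    exact (hσ₀ σ).trans_lt hM.1
  obtain ⟨M, hM, hM4 : M < 4⟩ := (hev.and self_mem_nhdsWithin).exists
  obtain ⟨r, hMr, hr4⟩ := exists_rat_btwn hM4
  exact ⟨r, by exact_mod_cast hr4, fun t ht σ => (hM t ht σ).trans hMr⟩

theorem exists_forall_inBox (S : Finset (𝓞 𝕋))
    (hS : ∀ t ∈ S, ∀ σ : 𝕋 →+* ℝ, 0 < σ t ∧ σ t < 4) :
    ∃ a b : 𝓞 𝕋, SquareLT 0 b ∧ SquareLT a (4 * b) ∧ ∀ t ∈ S, InBox a b t := by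
  obtain ⟨r, hr4, hr⟩ := exists_rat_lt_four S fun t ht σ => (hS t ht σ).2
  have hden : (0 : ℝ) < r.den := by exact_mod_cast r.den_pos
  have hnum : (r.num : ℝ) = r.den * r := by exact_mod_cast (Rat.den_mul_eq_num r).symm
  have hr4' : (r : ℝ) < 4 := by exact_mod_cast hr4
  refine ⟨r.num, r.den, squareLT_iff.2 fun σ => ?_, squareLT_iff.2 fun σ => ?_,
    fun t ht => inBox_iff.2 fun σ => ?_⟩
  · simpa using r.den_pos
  · simp only [map_mul, map_intCast, map_natCast, map_ofNat, hnum, mul_comm (4 : ℝ)]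
    exact mul_lt_mul_of_pos_left hr4' hden
  · simp only [map_intCast, map_natCast, hnum]
    exact ⟨mul_pos hden (hS t ht σ).1, mul_lt_mul_of_pos_left (hr t ht σ) hden⟩

theorem exists_inBox_surjOn (n : ℕ) : ∃ a b : 𝓞 𝕋, SquareLT 0 b ∧ SquareLT a (4 * b) ∧
    ∃ c : 𝓞 𝕋 → Fin (n + 1), {s | InBox a b s}.SurjOn c Set.univ := by
  obtain ⟨S, hS, hcard⟩ := infinite_setOf_embedding_lt_four.exists_subset_card_eq (n + 1)
  obtain ⟨a, b, hb, hab, h⟩ := exists_forall_inBox S fun t ht => hS ht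
  let e := S.equivFinOfCardEq hcard
  classical
  refine ⟨a, b, hb, hab, fun s => if hs : s ∈ S then e ⟨s, hs⟩ else 0, fun i _ => ?_⟩
  exact ⟨e.symm i, h _ (e.symm i).2, by simp⟩

theorem isNatural_natCast (n : ℕ) : IsNatural (n : 𝓞 𝕋) := by
  obtain ⟨a, b, hb, hab, c, hc⟩ := exists_inBox_surjOn n
  have hfin := finite_inBox hb hab
  obtain ⟨d, hnd, hd⟩ := exists_lt_natCast_sub_dvd hfin n
  obtain ⟨g, hg⟩ := exists_forall_dvd_sub hfin (m := fun s => 1 + (1 + s) * (d : 𝓞 𝕋))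
    (hd.mono' fun s t => isCoprime_one_add_mul) fun s => (c s : ℕ)
  have hlt (s : 𝓞 𝕋) (hs : InBox a b s) : SquareLT (n : 𝓞 𝕋) (1 + (1 + s) * d) := by
    refine squareLT_iff.2 fun σ => ?_
    have hσb : 0 < σ b := by simpa using squareLT_iff.1 hb σ
    have hσs := pos_of_mul_pos_right (inBox_iff.1 hs σ).1 hσb.le
    have hnd' : (n : ℝ) < d := by exact_mod_cast hnd
    simp only [map_add, map_one, map_mul, map_natCast]
    nlinarith [Nat.cast_nonneg (α := ℝ) d]
  have hnonneg (i : ℕ) : SquareLE (0 : 𝓞 𝕋) i := squareLE_iff.2 fun σ => by simp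
  have hle (i : Fin (n + 1)) : SquareLE ((i : ℕ) : 𝓞 𝕋) n :=
    squareLE_iff.2 fun σ => by simpa using i.is_le
  have hres (i : Fin (n + 1)) : IsResidue a b (d : 𝓞 𝕋) g n (i : ℕ) := by
    obtain ⟨s, hs, rfl⟩ := hc (Set.mem_univ i)
    exact ⟨hnonneg _, hle _, s, hs, hg s hs⟩
  refine ⟨a, b, d, g, n, hb, hab, hlt, by simpa using hres 0, ?_⟩
  rintro v ⟨hv, hvn, s, hs, hgv⟩
  obtain rfl : v = (c s : ℕ) := eq_of_dvd_sub hv hvn (hnonneg _) (hle _) (hlt s hs)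
    (by simpa using dvd_sub (hg s hs) hgv)
  rcases (c s).is_le.eq_or_lt with h | h
  · exact .inl (congrArg Nat.cast h)
  · exact .inr (by simpa using hres ⟨c s + 1, Nat.succ_lt_succ h⟩)

theorem definable_range_natCast :
    (∅ : Set (𝓞 𝕋)).Definable₁ ringLanguage (Set.range Nat.cast) := by
  have : Set.range Nat.cast = {x : 𝓞 𝕋 | IsNatural x} :=
    Set.Subset.antisymm (Set.range_subset_iff.2 isNatural_natCast)
      fun _ => mem_range_natCast_of_isNatural
  exact this ▸ definable_isNatural

end Robinson

end totallyRealNumbers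

theorem mainTheorem8 :
    -- the first-order theory of the ring of integers of `T` is undecidable
    ¬ ringLanguage.DecidableTheory (ringLanguage.completeTheory (𝓞 totallyRealNumbers)) ∧
    -- the set of natural numbers is definable in it, without parameters
    (∅ : Set (𝓞 totallyRealNumbers)).Definable₁ ringLanguage
      (Set.range (Nat.cast : ℕ → 𝓞 totallyRealNumbers)) ∧
    -- `4` is the least real `M` with infinitely many `t` such that `0 ≪ t ≪ M`
    IsLeast {M : ℝ | {t : 𝓞 totallyRealNumbers | ∀ σ : totallyRealNumbers →+* ℝ,
      0 < σ (t : totallyRealNumbers) ∧ σ (t : totallyRealNumbers) < M}.Infinite} 4 :=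
  ⟨ringLanguage.not_decidableTheory_completeTheory totallyRealNumbers.definable_range_natCast,
    totallyRealNumbers.definable_range_natCast, totallyRealNumbers.isLeast_four⟩
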